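/- Let $C$ be a nonzero commutative ring with identity of positive characteristic, let $A$ be a commutative unital $C$-algebra whose structure map $C\to A$ is injective ($A\supseteq C$), and let $\lambda\in C$. All tensor products are over $C$. Let $Ш_C(A)=\bigoplus_{k\ge 0}A^{\otimes(k+1)}$ be the shuffle Baxter algebra of weight $\lambda$, i.e. the natural $C$-module with the mixed shuffle product: the $C$-bilinear product with $$(x_0\otimes x_1\otimes\cdots\otimes x_m)\diamond(y_0\otimes y_1\otimes\cdots\otimes y_n)=\sum_{(\sigma,T)}\lambda^{|T|}\,x_0y_0\otimes\sigma(x^+\otimes y^+;T).$$ Here $\sigma$ runs over the $(m,n)$-shuffles, i.e. the permutations of $\{1,\dots,m+n\}$ with $\sigma^{-1}(1)<\cdots<\sigma^{-1}(m)$ and $\sigma^{-1}(m+1)<\cdots<\sigma^{-1}(m+n)$, and $T$ runs over the sets of pairs $(k,k+1)$, $1\le k<m+n$, with $\sigma(k)\le m<\sigma(k+1)$. With $(u_1,\dots,u_{m+n})=(x_1,\dots,x_m,y_1,\dots,y_n)$, the element $\sigma(x^+\otimes y^+;T)\in A^{\otimes(m+n-|T|)}$ is obtained from $u_{\sigma(1)}\otimes\cdots\otimes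 u_{\sigma(m+n)}$ by replacing the tensor sign between positions $k$ and $k+1$ by the product of $A$ for every $(k,k+1)\in T$. (If $m=n=0$ the product is $x_0y_0\in A$.) Let $\widehat{Ш}_C(A)=\varprojlim_k Ш_C(A)/\mathrm{Fil}^k$, where $\mathrm{Fil}^k=\bigoplus_{n\ge k}A^{\otimes(n+1)}$; as a $C$-module it is identified with $\prod_{n\ge 0}A^{\otimes(n+1)}$ by taking components. Write $N(R)$ for the nilradical of a commutative ring $R$. 1. Neither $Ш_C(A)$ nor $\widehat{Ш}_C(A)$ is an integral domain. 2. If $\lambda=0$, then neither $Ш_C(A)$ nor $\widehat{Ш}_C(A)$ is reduced, and $$N(Ш_C(A))=N(A)\oplus\bigoplus_{n\ge1}A^{\otimes(n+1)},\qquad N(\widehat{Ш}_C(A))\subseteq N(A)\times\prod_{n\ge1}A^{\otimes(n+1)}.$$ 3. If $\lambda\ne0$, and if for every $k\ge1$ the element $\lambda$ has trivial annihilator in the $C$-module $A^{\otimes k}$ (that is, $\lambda x=0$ implies $x=0$) and the tensor power algebra $A^{\otimes k}$, with its factorwise product, is reduced, then $Ш_C(A)$ and $\widehat{Ш}_C(A)$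 are both reduced. -/

import Mathlib

open scoped TensorProduct DirectSum

namespace BaxterShuffle

/-! ### Mixable shuffles -/

/-- `(σ, T)` is a mixable `(m, n)`-shuffle. Positions and letters are numbered from `0`, so that
the letters `0, …, m - 1` belong to the left factor and `m, …, m + n - 1` to the right one.
The admissible pair `(k, k + 1)` is represented by its first entry `k`. -/
def IsMixable (m n : ℕ) (σ : Equiv.Perm (Fin (m + n))) (T : Finset (Fin (m + n))) : Prop :=
  StrictMono (fun i : Fin m => σ.symm (Fin.castAdd n i)) ∧
  StrictMono (fun j : Fin n => σ.symm (Fin.natAdd m j)) ∧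
  ∀ k ∈ T, ∃ k' : Fin (m + n), (k' : ℕ) = k + 1 ∧ (σ k : ℕ) < m ∧ m ≤ (σ k' : ℕ)

/-- The set of mixable `(m, n)`-shuffles. -/
structure MixShuffle (m n : ℕ) where
  perm : Equiv.Perm (Fin (m + n))
  merged : Finset (Fin (m + n))
  isMixable : IsMixable m n perm merged

theorem MixShuffle.ext' {m n : ℕ} {s t : MixShuffle m n} (h : s.perm = t.perm)
    (h' : s.merged = t.merged) : s = t := by
  cases s; cases t; simp only at h h'; subst h; subst h'; rfl

noncomputable instance (m n : ℕ) : Fintype (MixShuffle m n) :=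
  Fintype.ofInjective (fun s : MixShuffle m n => (s.perm, s.merged)) (fun _ _ h =>
    MixShuffle.ext' (congrArg Prod.fst h) (congrArg Prod.snd h))

/-- The number of tensor factors of `σ(x ⊗ y; T)`. -/
def MixShuffle.len {m n : ℕ} (s : MixShuffle m n) : ℕ := m + n - s.merged.card

theorem MixShuffle.card_filter_le {m n : ℕ} (s : MixShuffle m n) (k : ℕ) :
    (s.merged.filter (fun t : Fin (m + n) => (t : ℕ) < k)).card ≤ k := by
  have : (s.merged.filter (fun t : Fin (m + n) => (t : ℕ) < k)).card ≤ (Finset.range k).card :=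
    Finset.card_le_card_of_injOn (fun t => (t : ℕ)) (by
      intro t ht
      simp at ht
      simpa using ht.2) (fun a _ b _ h => Fin.ext h)
  simpa using this

theorem MixShuffle.card_merged_lt {m n : ℕ} (s : MixShuffle m n) (k : Fin (m + n)) :
    (k : ℕ) - (s.merged.filter (fun t : Fin (m + n) => (t : ℕ) < k)).card < s.len := by
  have h1 : (s.merged.filter (fun t : Fin (m + n) => ¬ (t : ℕ) < k)).card ≤
      (Finset.Ico (k : ℕ) (m + n - 1)).card :=
    Finset.card_le_card_of_injOn (fun t => (t : ℕ)) (by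
      intro t ht
      simp at ht
      obtain ⟨k', h, -⟩ := s.isMixable.2.2 t ht.1
      have := k'.2
      simp
      omega) (fun a _ b _ h => Fin.ext h)
  have h2 := Finset.card_filter_add_card_filter_not (s := s.merged) (fun t : Fin (m + n) => (t : ℕ) < k)
  have h3 := s.card_filter_le k
  rw [Nat.card_Ico] at h1
  have := k.2
  unfold MixShuffle.len
  omega

/-- The tensor factor of `σ(x ⊗ y; T)` in which the letter at position `k` ends up once
`(t, t + 1)` has been merged for every `t ∈ T`. -/
def MixShuffle.block {m n : ℕ} (s : MixShuffle m n) (k : Fin (m + n)) : Fin s.len :=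
  ⟨k - (s.merged.filter (fun t : Fin (m + n) => (t : ℕ) < k)).card, s.card_merged_lt k⟩

/-! ### Combinatorics of blocks -/

theorem MixShuffle.block_succ {m n : ℕ} (s : MixShuffle m n) (k k' : Fin (m + n))
    (h : (k' : ℕ) = k + 1) :
    (s.block k' : ℕ) = s.block k + if k ∈ s.merged then 0 else 1 := by
  have h3 := s.card_filter_le k
  have : s.merged.filter (fun t : Fin (m + n) => (t : ℕ) < k') =
      (s.merged.filter (fun t : Fin (m + n) => (t : ℕ) < k)) ∪ (s.merged.filter (fun t : Fin (m + n) => t = k)) := by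
    ext t
    simp only [Finset.mem_filter, Finset.mem_union, Fin.ext_iff]
    constructor
    · rintro ⟨a, b⟩
      by_cases hh : (t : ℕ) = k
      · exact Or.inr ⟨a, hh⟩
      · exact Or.inl ⟨a, by omega⟩
    · rintro (⟨a, b⟩ | ⟨a, b⟩)
      · exact ⟨a, by omega⟩
      · exact ⟨a, by omega⟩
  have hd : Disjoint (s.merged.filter (fun t : Fin (m + n) => (t : ℕ) < k))
      (s.merged.filter (fun t : Fin (m + n) => t = k)) := by
    rw [Finset.disjoint_filter]
    rintro t - h1 rfl
    exact lt_irrefl _ h1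
  have hc := Finset.card_union_of_disjoint hd
  rw [← this, Finset.filter_eq'] at hc
  change (k' : ℕ) - _ = (k : ℕ) - _ + _
  rw [hc, h]
  split_ifs
  · rw [Finset.card_singleton]; omega
  · rw [Finset.card_empty]; omega

/-- A weakly increasing sequence whose ties between neighbours are exactly the merged pairs has
the same order pattern as the block numbers. -/
theorem MixShuffle.block_pattern {m n : ℕ} (s : MixShuffle m n) (v : Fin (m + n) → ℕ)
    (hv : Monotone v)
    (hT : ∀ k k' : Fin (m + n), (k' : ℕ) = k + 1 → (v k = v k' ↔ k ∈ s.merged)) :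
    ∀ i j : Fin (m + n), i ≤ j → s.block i ≤ s.block j ∧ (v i = v j ↔ s.block i = s.block j) := by
  have key : ∀ (d : ℕ) (i j : Fin (m + n)), (j : ℕ) = i + d →
      s.block i ≤ s.block j ∧ (v i = v j ↔ s.block i = s.block j) := by
    intro d
    induction d with
    | zero =>
      intro i j h
      have : j = i := Fin.ext h
      subst this
      simp
    | succ d ih =>
      intro i j h
      have hj := j.2
      obtain ⟨h1, h2⟩ := ih i ⟨i + d, by omega⟩ rfl
      have h3 := s.block_succ ⟨i + d, by omega⟩ j (by simp; omega)
      have h4 := hT ⟨i + d, by omega⟩ j (by simp; omega)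
      have h5 : v i ≤ v ⟨i + d, by omega⟩ := hv (by simp [Fin.le_def])
      have h6 : v ⟨i + d, by omega⟩ ≤ v j := hv (by simp [Fin.le_def]; omega)
      rw [Fin.le_def] at h1 ⊢
      rw [Fin.ext_iff] at h2 ⊢
      split_ifs at h3 with hm
      · rw [← h4.2 hm]
        exact ⟨by omega, by rw [h2]; omega⟩
      · have : v ⟨i + d, by omega⟩ ≠ v j := fun h => hm (h4.1 h)
        refine ⟨by omega, ⟨fun h => ?_, fun h => ?_⟩⟩ <;> omega
  intro i j hij
  exact key (j - i) i j (by rw [Fin.le_def] at hij; omega)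

theorem MixShuffle.block_eq_iff {m n : ℕ} (s : MixShuffle m n) (k k' : Fin (m + n))
    (h : (k' : ℕ) = k + 1) : s.block k = s.block k' ↔ k ∈ s.merged := by
  have := s.block_succ k k' h
  rw [Fin.ext_iff]
  split_ifs at this with hm <;> simp [hm] <;> omega

theorem MixShuffle.block_mono {m n : ℕ} (s : MixShuffle m n) : Monotone s.block := by
  have key : ∀ (d : ℕ) (i j : Fin (m + n)), (j : ℕ) = i + d → s.block i ≤ s.block j := by
    intro d
    induction d with
    | zero =>
      intro i j h
      have : j = i := Fin.ext h
      subst this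
      exact le_rfl
    | succ d ih =>
      intro i j h
      have hj := j.2
      have h1 := ih i ⟨i + d, by omega⟩ rfl
      have h3 := s.block_succ ⟨i + d, by omega⟩ j (by simp; omega)
      rw [Fin.le_def] at h1 ⊢
      omega
  intro i j hij
  exact key (j - i) i j (by rw [Fin.le_def] at hij; omega)

theorem MixShuffle.block_surj {m n : ℕ} (s : MixShuffle m n) : Function.Surjective s.block := by
  have key : ∀ (d : ℕ) (hd : d < m + n) (b : ℕ), b ≤ s.block ⟨d, hd⟩ →
      ∃ k, (s.block k : ℕ) = b := by
    intro d
    induction d with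
    | zero =>
      intro hd b hb
      refine ⟨⟨0, hd⟩, ?_⟩
      simp [MixShuffle.block] at hb ⊢
      omega
    | succ d ih =>
      intro hd b hb
      have h3 := s.block_succ ⟨d, by omega⟩ ⟨d + 1, hd⟩ rfl
      by_cases hh : b ≤ s.block ⟨d, by omega⟩
      · exact ih (by omega) b hh
      · refine ⟨⟨d + 1, hd⟩, ?_⟩
        split_ifs at h3 <;> omega
  intro b
  have hb := b.2
  have hlen : s.len = m + n - s.merged.card := rfl
  have hpos : 0 < m + n := by omega
  obtain ⟨k, hk⟩ := key (m + n - 1) (by omega) b (by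
    have hl : s.merged.filter (fun t : Fin (m + n) => (t : ℕ) < m + n - 1) = s.merged := by
      refine Finset.filter_true_of_mem fun t ht => ?_
      obtain ⟨k', h, -⟩ := s.isMixable.2.2 t ht
      have := k'.2
      omega
    simp only [MixShuffle.block, hl]
    omega)
  exact ⟨k, Fin.ext hk⟩

/-- The two families of positions of a mixable shuffle. -/
def StrictOnParts (m n : ℕ) {r : ℕ} (h : Fin (m + n) → Fin r) : Prop :=
  StrictMono (fun i : Fin m => h (Fin.castAdd n i)) ∧
  StrictMono (fun j : Fin n => h (Fin.natAdd m j))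

theorem MixShuffle.block_tie {m n : ℕ} (s : MixShuffle m n) (i j : Fin (m + n)) (hij : i < j)
    (h : s.block i = s.block j) :
    (j : ℕ) = i + 1 ∧ (s.perm i : ℕ) < m ∧ m ≤ (s.perm j : ℕ) := by
  have hj := j.2
  have hij' : (i : ℕ) < j := hij
  let i' : Fin (m + n) := ⟨i + 1, by omega⟩
  have hi' : i' ≤ j := by rw [Fin.le_def]; simp [i']; omega
  have h1 : s.block i = s.block i' := le_antisymm
    (s.block_mono (by rw [Fin.le_def]; simp [i'])) (h ▸ s.block_mono hi')
  obtain ⟨k', hk', ha, hb⟩ := s.isMixable.2.2 i ((s.block_eq_iff i i' rfl).1 h1)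
  have hk : k' = i' := Fin.ext hk'
  subst hk
  rcases eq_or_lt_of_le hi' with he | hlt
  · rw [← he]
    exact ⟨rfl, ha, hb⟩
  · exfalso
    have hlt' : (i : ℕ) + 1 < j := hlt
    let i'' : Fin (m + n) := ⟨i + 2, by omega⟩
    have hi'' : i'' ≤ j := by rw [Fin.le_def]; simp [i'']; omega
    have h2 : s.block i' = s.block i'' := le_antisymm
      (s.block_mono (by rw [Fin.le_def]; simp [i', i''])) (h1 ▸ h ▸ s.block_mono hi'')
    obtain ⟨k', hk', hc, hd⟩ := s.isMixable.2.2 i' ((s.block_eq_iff i' i'' rfl).1 h2)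
    omega

theorem MixShuffle.block_strictOnParts {m n : ℕ} (s : MixShuffle m n) :
    StrictOnParts m n (fun i => s.block (s.perm.symm i)) := by
  constructor
  · intro a b hab
    have h1 := s.isMixable.1 hab
    refine lt_of_le_of_ne (s.block_mono h1.le) fun h => ?_
    have := (s.block_tie _ _ h1 h).2
    simp at this
    have := b.2
    omega
  · intro a b hab
    have h1 := s.isMixable.2.1 hab
    refine lt_of_le_of_ne (s.block_mono h1.le) fun h => ?_
    have := (s.block_tie _ _ h1 h).2
    simp at this

theorem MixShuffle.exists_factor {m n r : ℕ} (h : Fin (m + n) → Fin r)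
    (hh : StrictOnParts m n h) :
    ∃ (s : MixShuffle m n) (k : Fin s.len → Fin r), StrictMono k ∧
      (fun i => k (s.block (s.perm.symm i))) = h := by
  classical
  set σ := Tuple.sort h with hσ
  have hmono : Monotone (h ∘ σ) := Tuple.monotone_sort h
  have htie : ∀ i j, i < j → h (σ i) = h (σ j) → σ i < σ j :=
    (Tuple.eq_sort_iff.1 hσ).2
  have hlt : ∀ a b, h a < h b → σ.symm a < σ.symm b := by
    intro a b hab
    by_contra hc
    have := hmono (not_lt.1 hc)
    simp at this
    exact absurd hab (not_lt.2 this)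
  let s : MixShuffle m n :=
    { perm := σ
      merged := Finset.univ.filter fun t => ∃ t' : Fin (m + n), (t' : ℕ) = t + 1 ∧
        h (σ t) = h (σ t')
      isMixable := by
        refine ⟨fun a b hab => hlt _ _ (hh.1 hab), fun a b hab => hlt _ _ (hh.2 hab), ?_⟩
        intro k hk
        obtain ⟨k', hk', he⟩ := (Finset.mem_filter.1 hk).2
        refine ⟨k', hk', ?_⟩
        have hl := htie k k' (by rw [Fin.lt_def]; omega) he
        by_cases h1 : (σ k' : ℕ) < m
        · exfalso
          have := hh.1 (show (⟨σ k, lt_trans hl h1⟩ : Fin m) < ⟨σ k', h1⟩ from hl)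
          exact absurd he this.ne
        · refine ⟨?_, not_lt.1 h1⟩
          by_contra h2
          have hk2 := (σ k).2
          have hk2' := (σ k').2
          have hl' : (σ k : ℕ) < σ k' := hl
          have := hh.2 (show (⟨σ k - m, by omega⟩ : Fin n) < ⟨σ k' - m, by omega⟩ by
            rw [Fin.lt_def]; simp only; omega)
          have e1 : Fin.natAdd m (⟨σ k - m, by omega⟩ : Fin n) = σ k := by
            ext; simp; omega
          have e2 : Fin.natAdd m (⟨σ k' - m, by omega⟩ : Fin n) = σ k' := by
            ext; simp; omega
          simp only [e1, e2] at this
          exact absurd he this.ne }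
  have pat := s.block_pattern (fun i => (h (σ i) : ℕ)) (fun i j hij => hmono hij) (by
    intro k k' hk
    simp only [s, Finset.mem_filter, Finset.mem_univ, true_and]
    rw [← Fin.ext_iff]
    constructor
    · intro he; exact ⟨k', hk, he⟩
    · rintro ⟨t', ht', he⟩
      have : t' = k' := Fin.ext (by omega)
      rwa [this] at he)
  have pat' : ∀ i j, s.block i = s.block j → h (σ i) = h (σ j) := by
    intro i j he
    rcases le_total i j with hij | hij
    · exact Fin.ext ((pat i j hij).2.2 he)
    · exact (Fin.ext ((pat j i hij).2.2 he.symm)).symm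
  choose sec hsec using s.block_surj
  refine ⟨s, fun b => h (σ (sec b)), ?_, ?_⟩
  · intro a b hab
    have h1 : sec a < sec b := by
      by_contra hc
      have := s.block_mono (not_lt.1 hc)
      rw [hsec, hsec] at this
      exact absurd hab (not_lt.2 this)
    refine lt_of_le_of_ne (hmono h1.le) fun he => ?_
    have := (pat _ _ h1.le).2.1 (congrArg Fin.val he)
    rw [hsec, hsec] at this
    exact hab.ne this
  · funext i
    have := pat' (sec (s.block (s.perm.symm i))) (s.perm.symm i) (hsec _)
    exact this.trans (congrArg h (σ.apply_symm_apply i))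

theorem MixShuffle.factor_unique {m n r : ℕ} (s t : MixShuffle m n) (k : Fin s.len → Fin r)
    (l : Fin t.len → Fin r) (hk : StrictMono k) (hl : StrictMono l)
    (h : (fun i => k (s.block (s.perm.symm i))) = fun i => l (t.block (t.perm.symm i))) :
    (⟨s, k⟩ : (s : MixShuffle m n) × (Fin s.len → Fin r)) = ⟨t, l⟩ := by
  have aux : ∀ (s : MixShuffle m n) (k : Fin s.len → Fin r), StrictMono k →
      s.perm = Tuple.sort (fun i => k (s.block (s.perm.symm i))) := by
    intro s k hk
    rw [Tuple.eq_sort_iff]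
    constructor
    · intro i j hij
      simpa using hk.monotone (s.block_mono hij)
    · intro i j hij he
      simp only [Equiv.symm_apply_apply] at he
      have := s.block_tie i j hij (hk.injective he)
      rw [Fin.lt_def]
      omega
  have hp : s.perm = t.perm := by rw [aux s k hk, aux t l hl, h]
  have hv : ∀ i, k (s.block i) = l (t.block i) := by
    intro i
    have := congrFun h (s.perm i)
    simp only [Equiv.symm_apply_apply] at this
    rw [this, hp, Equiv.symm_apply_apply]
  have hm : s.merged = t.merged := by
    have sub : ∀ (s t : MixShuffle m n) (k : Fin s.len → Fin r) (l : Fin t.len → Fin r),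
        StrictMono k → StrictMono l → (∀ i, k (s.block i) = l (t.block i)) →
        s.merged ⊆ t.merged := by
      intro s t k l hk hl hv a ha
      obtain ⟨a', ha', -⟩ := s.isMixable.2.2 a ha
      have h1 := (s.block_eq_iff a a' ha').2 ha
      refine (t.block_eq_iff a a' ha').1 (hl.injective ?_)
      rw [← hv, ← hv, h1]
    exact (sub s t k l hk hl hv).antisymm (sub t s l k hl hk fun i => (hv i).symm)
  obtain rfl := MixShuffle.ext' hp hm
  have : k = l := by
    funext b
    obtain ⟨i, rfl⟩ := s.block_surj b
    exact hv i
  rw [this]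

/-- The letters of the left factor, and of the right factor, sent to their tensor factor. -/
def MixShuffle.left {m n : ℕ} (s : MixShuffle m n) (i : Fin m) : Fin s.len :=
  s.block (s.perm.symm (Fin.castAdd n i))

def MixShuffle.right {m n : ℕ} (s : MixShuffle m n) (j : Fin n) : Fin s.len :=
  s.block (s.perm.symm (Fin.natAdd m j))

open Classical in
theorem MixShuffle.sum_pairs {M : Type*} [AddCommMonoid M] (m n r : ℕ)
    (F : (Fin m → Fin r) → (Fin n → Fin r) → M) :
    ∑ f : Fin m → Fin r with StrictMono f, ∑ g : Fin n → Fin r with StrictMono g, F f g =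
      ∑ s : MixShuffle m n, ∑ k : Fin s.len → Fin r with StrictMono k,
        F (k ∘ s.left) (k ∘ s.right) := by
  rw [← Finset.sum_product', Finset.sum_sigma']
  symm
  refine Finset.sum_bij (fun p _ => (p.2 ∘ p.1.left, p.2 ∘ p.1.right)) ?_ ?_ ?_ ?_
  · rintro ⟨s, k⟩ hk
    simp only [Finset.mem_sigma, Finset.mem_univ, Finset.mem_filter, true_and] at hk
    simp only [Finset.mem_product, Finset.mem_univ, Finset.mem_filter, true_and]
    exact ⟨hk.comp s.block_strictOnParts.1, hk.comp s.block_strictOnParts.2⟩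
  · rintro ⟨s, k⟩ hk ⟨t, l⟩ hl he
    simp only [Finset.mem_sigma, Finset.mem_univ, Finset.mem_filter, true_and] at hk hl
    refine MixShuffle.factor_unique s t k l hk hl ?_
    funext i
    refine Fin.addCases (fun a => ?_) (fun b => ?_) i
    · exact congrFun (congrArg Prod.fst he) a
    · exact congrFun (congrArg Prod.snd he) b
  · rintro ⟨f, g⟩ hfg
    simp only [Finset.mem_product, Finset.mem_univ, Finset.mem_filter, true_and] at hfg
    obtain ⟨s, k, hk, he⟩ := MixShuffle.exists_factor (m := m) (n := n) (Fin.append f g)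
      ⟨by simpa using hfg.1, by simpa using hfg.2⟩
    refine ⟨⟨s, k⟩, by simpa using hk, ?_⟩
    refine Prod.ext ?_ ?_
    · funext a
      simpa [MixShuffle.left] using congrFun he (Fin.castAdd n a)
    · funext b
      simpa [MixShuffle.right] using congrFun he (Fin.natAdd m b)
  · rintro ⟨s, k⟩ _
    rfl

/-! ### Maps between tensor power algebras -/

section Algebra

universe u v

variable (C : Type u) [CommRing C] (A : Type v) [CommRing A] [Algebra C A]

/-- For `f : Fin m → Fin r`, the algebra homomorphism of tensor power algebras
`A^{⊗ m} → A^{⊗ r}` that multiplies together the tensor factors with the same image under `f`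
(and puts `1` where there is none). -/
noncomputable def push {m r : ℕ} (f : Fin m → Fin r) : (⨂[C]^m A) →ₐ[C] ⨂[C]^r A :=
  PiTensorProduct.liftAlgHom
    { toFun := fun x => ∏ i, PiTensorProduct.singleAlgHom (R := C) (A := fun _ => A) (f i) (x i)
      map_update_add' := by
        intro _ x i a b
        simp only [← Finset.mul_prod_erase _ _ (Finset.mem_univ i), Function.update_self, map_add,
          add_mul]
        congr 1 <;> congr 1 <;> refine Finset.prod_congr rfl fun j hj => ?_ <;>
          rw [Function.update_of_ne (Finset.ne_of_mem_erase hj),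
            Function.update_of_ne (Finset.ne_of_mem_erase hj)]
      map_update_smul' := by
        intro _ x i c a
        simp only [← Finset.mul_prod_erase _ _ (Finset.mem_univ i), Function.update_self, map_smul,
          smul_mul_assoc]
        congr 2
        refine Finset.prod_congr rfl fun j hj => ?_
        rw [Function.update_of_ne (Finset.ne_of_mem_erase hj),
            Function.update_of_ne (Finset.ne_of_mem_erase hj)] }
    (by simp only [MultilinearMap.coe_mk, Pi.one_apply, map_one, Finset.prod_const_one])
    (fun x y => by
      simp only [MultilinearMap.coe_mk, Pi.mul_apply, map_mul, Finset.prod_mul_distrib])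

theorem push_tprod {m r : ℕ} (f : Fin m → Fin r) (x : Fin m → A) :
    push C A f (PiTensorProduct.tprod C x) =
      PiTensorProduct.tprod C fun j => ∏ i with f i = j, x i := by
  have h : push C A f (PiTensorProduct.tprod C x) =
      ∏ i, PiTensorProduct.singleAlgHom (R := C) (A := fun _ => A) (f i) (x i) := by
    simp only [push, PiTensorProduct.liftAlgHom_apply, PiTensorProduct.lift.tprod,
      MultilinearMap.coe_mk]
  rw [h]
  simp only [PiTensorProduct.singleAlgHom_apply]
  rw [← PiTensorProduct.tprod_prod]
  congr 1
  funext j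
  rw [Finset.prod_apply, Finset.prod_filter]
  refine Finset.prod_congr rfl fun i _ => ?_
  simp only [MonoidHom.mulSingle_apply, Pi.mulSingle_apply, eq_comm]

theorem push_push {m r s : ℕ} (f : Fin m → Fin r) (g : Fin r → Fin s) (x : ⨂[C]^m A) :
    push C A g (push C A f x) = push C A (g ∘ f) x := by
  induction x using PiTensorProduct.induction_on with
  | smul_tprod c x =>
    simp only [map_smul, push_tprod]
    congr 2
    funext j
    rw [Finset.prod_sigma']
    refine Finset.prod_bij (fun p _ => p.2) ?_ ?_ ?_ ?_
    · rintro ⟨a, b⟩ h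
      simp only [Finset.mem_sigma, Finset.mem_filter, Finset.mem_univ, true_and] at h
      simp [h.1, h.2]
    · rintro ⟨a, b⟩ h ⟨a', b'⟩ h' he
      simp only [Finset.mem_sigma, Finset.mem_filter, Finset.mem_univ, true_and] at h h' he
      subst he
      simp [← h.2, ← h'.2]
    · intro b hb
      simp only [Finset.mem_filter, Finset.mem_univ, true_and, Function.comp_apply] at hb
      exact ⟨⟨f b, b⟩, by simp [hb], rfl⟩
    · simp
  | add x y hx hy => simp only [map_add, hx, hy]

theorem push_id {m : ℕ} (x : ⨂[C]^m A) : push C A id x = x := by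
  induction x using PiTensorProduct.induction_on with
  | smul_tprod c x =>
    simp only [map_smul, push_tprod, id, Finset.filter_eq', Finset.mem_univ, if_true,
      Finset.prod_singleton]
  | add x y hx hy => simp only [map_add, hx, hy]

/-- Extend `f : Fin m → Fin r` by `0 ↦ 0`. -/
def ext0 {m r : ℕ} (f : Fin m → Fin r) : Fin (m + 1) → Fin (r + 1) :=
  Fin.cons 0 (fun i => (f i).succ)

theorem ext0_comp {m r s : ℕ} (f : Fin m → Fin r) (g : Fin r → Fin s) :
    ext0 (g ∘ f) = ext0 g ∘ ext0 f := by
  funext i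
  refine Fin.cases ?_ (fun i => ?_) i <;> simp [ext0]

theorem ext0_id {m : ℕ} : ext0 (id : Fin m → Fin m) = id := by
  funext i
  refine Fin.cases ?_ (fun i => ?_) i <;> simp [ext0]

/-- The product over all letters of `x⁺` and `y⁺`, merged according to a mixable shuffle, times
`x₀ y₀` in the zeroth factor: the bilinear extension of
`(x₀ ⊗ x⁺, y₀ ⊗ y⁺) ↦ x₀ y₀ ⊗ σ(x⁺ ⊗ y⁺; T)`, see `mixTerm_tprod`. -/
noncomputable def mixTerm {m n : ℕ} (s : MixShuffle m n) :
    (⨂[C]^(m + 1) A) →ₗ[C] (⨂[C]^(n + 1) A) →ₗ[C] ⨂[C]^(s.len + 1) A :=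
  (LinearMap.mul C (⨂[C]^(s.len + 1) A)).compl₁₂
    (push C A (ext0 s.left)).toLinearMap (push C A (ext0 s.right)).toLinearMap

theorem mixTerm_apply {m n : ℕ} (s : MixShuffle m n) (x : ⨂[C]^(m + 1) A) (y : ⨂[C]^(n + 1) A) :
    mixTerm C A s x y = push C A (ext0 s.left) x * push C A (ext0 s.right) y := rfl

/-- On pure tensors, `mixTerm` is `x₀ y₀ ⊗ σ(x⁺ ⊗ y⁺; T)`: with
`u = (x₁, …, x_m, y₁, …, y_n)`, the tensor factor number `j` is the product of the letters
`u_{σ(k)}` over the positions `k` that are merged into that factor. -/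
theorem mixTerm_tprod {m n : ℕ} (s : MixShuffle m n) (x : Fin (m + 1) → A) (y : Fin (n + 1) → A) :
    mixTerm C A s (PiTensorProduct.tprod C x) (PiTensorProduct.tprod C y) =
      PiTensorProduct.tprod C (Fin.cons (x 0 * y 0) (fun j : Fin s.len =>
        ∏ k with s.block k = j, Fin.append (Fin.tail x) (Fin.tail y) (s.perm k)) :
          Fin (s.len + 1) → A) := by
  rw [mixTerm_apply, push_tprod, push_tprod, PiTensorProduct.tprod_mul_tprod]
  congr 1
  funext j
  simp only [Pi.mul_apply, Finset.prod_filter, Fin.prod_univ_succ]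
  refine Fin.cases ?_ (fun j => ?_) j
  · simp [ext0, Fin.succ_ne_zero]
  · simp only [ext0, Fin.cons_zero, Fin.cons_succ, (Fin.succ_ne_zero j).symm, if_false, one_mul,
      Fin.succ_inj]
    rw [← Equiv.prod_comp s.perm.symm, Fin.prod_univ_add]
    simp [MixShuffle.left, MixShuffle.right, Fin.tail]
    congr!

/-! ### The shuffle algebra -/

/-- The underlying module `⨁_{k ≥ 0} A^{⊗ (k + 1)}` of `Ш_{C,λ}(A)`. -/
def Sha (_lam : C) : Type (max u v) := ⨁ k : ℕ, ⨂[C]^(k + 1) A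

namespace Sha

variable {C} (lam : C)

noncomputable instance : AddCommGroup (Sha C A lam) :=
  inferInstanceAs (AddCommGroup (⨁ k : ℕ, ⨂[C]^(k + 1) A))

noncomputable instance : Module C (Sha C A lam) :=
  inferInstanceAs (Module C (⨁ k : ℕ, ⨂[C]^(k + 1) A))

/-- The inclusion of `A^{⊗ (k + 1)}`. -/
noncomputable def of (k : ℕ) : (⨂[C]^(k + 1) A) →ₗ[C] Sha C A lam :=
  DirectSum.lof C ℕ (fun k => ⨂[C]^(k + 1) A) k

/-- The projection to `A^{⊗ (k + 1)}`. -/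
noncomputable def coeff (k : ℕ) : Sha C A lam →ₗ[C] ⨂[C]^(k + 1) A :=
  DirectSum.component C ℕ (fun k => ⨂[C]^(k + 1) A) k

/-- The product of two homogeneous elements,
`∑_{(σ, T)} λ^{|T|} x₀ y₀ ⊗ σ(x⁺ ⊗ y⁺; T)`. -/
noncomputable def homMul (m n : ℕ) :
    (⨂[C]^(m + 1) A) →ₗ[C] (⨂[C]^(n + 1) A) →ₗ[C] Sha C A lam :=
  ∑ s : MixShuffle m n, lam ^ s.merged.card • (mixTerm C A s).compr₂ (of A lam s.len)

/-- The mixed shuffle product. -/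
noncomputable def mulLin : Sha C A lam →ₗ[C] Sha C A lam →ₗ[C] Sha C A lam :=
  DirectSum.toModule C ℕ _ fun m =>
    (DirectSum.toModule C ℕ ((⨂[C]^(m + 1) A) →ₗ[C] Sha C A lam) fun n =>
      (homMul A lam m n).flip).flip

variable {A lam}

@[ext]
theorem ext_coeff {x y : Sha C A lam} (h : ∀ k, coeff A lam k x = coeff A lam k y) : x = y :=
  DFinsupp.ext h

theorem coeff_of_self (k : ℕ) (x : ⨂[C]^(k + 1) A) : coeff A lam k (of A lam k x) = x :=
  DirectSum.component.lof_self C (ι := ℕ) (M := fun k => ⨂[C]^(k + 1) A) k x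

theorem coeff_of_ne {k l : ℕ} (h : k ≠ l) (x : ⨂[C]^(k + 1) A) :
    coeff A lam l (of A lam k x) = 0 :=
  DFinsupp.single_eq_of_ne (Ne.symm h)

theorem hom_ext {M : Type*} [AddCommMonoid M] [Module C M] {f g : Sha C A lam →ₗ[C] M}
    (h : ∀ k, f ∘ₗ of A lam k = g ∘ₗ of A lam k) : f = g :=
  DirectSum.linearMap_ext C h

theorem induction {p : Sha C A lam → Prop} (h0 : p 0) (hof : ∀ k x, p (of A lam k x))
    (hadd : ∀ x y, p x → p y → p (x + y)) (x : Sha C A lam) : p x :=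
  DirectSum.induction_on x h0 hof hadd

theorem mulLin_of (m n : ℕ) (x : ⨂[C]^(m + 1) A) (y : ⨂[C]^(n + 1) A) :
    mulLin A lam (of A lam m x) (of A lam n y) = homMul A lam m n x y := by
  have h1 : mulLin A lam (of A lam m x) =
      (DirectSum.toModule C ℕ ((⨂[C]^(m + 1) A) →ₗ[C] Sha C A lam) fun n =>
      (homMul A lam m n).flip).flip x :=
    congrArg (fun f => f) (DirectSum.toModule_lof (R := C) (ι := ℕ)
      (M := fun k => ⨂[C]^(k + 1) A) m x)
  refine (LinearMap.congr_fun h1 _).trans ?_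
  exact LinearMap.congr_fun (DirectSum.toModule_lof (R := C) (ι := ℕ)
      (M := fun k => ⨂[C]^(k + 1) A) n y) x

theorem homMul_apply (m n : ℕ) (x : ⨂[C]^(m + 1) A) (y : ⨂[C]^(n + 1) A) :
    homMul A lam m n x y =
      ∑ s : MixShuffle m n, lam ^ s.merged.card • of A lam s.len (mixTerm C A s x y) := by
  simp [homMul]

open Classical in
/-- Sum over all ways of spreading a tensor over more factors, padding with `1`. -/
noncomputable def spread (A : Type v) [CommRing A] [Algebra C A] (m r : ℕ) :
    (⨂[C]^(m + 1) A) →ₗ[C] ⨂[C]^(r + 1) A :=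
  ∑ f : Fin m → Fin r with StrictMono f, (push C A (ext0 f)).toLinearMap

open Classical in
theorem spread_apply (m r : ℕ) (x : ⨂[C]^(m + 1) A) :
    spread A m r x = ∑ f : Fin m → Fin r with StrictMono f, push C A (ext0 f) x := by
  simp [spread]

theorem spread_self (m : ℕ) (x : ⨂[C]^(m + 1) A) : spread A m m x = x := by
  classical
  have : (Finset.univ.filter fun f : Fin m → Fin m => StrictMono f) = {id} := by
    ext f
    simp only [Finset.mem_filter, Finset.mem_univ, true_and, Finset.mem_singleton]
    constructor
    · intro h
      have h2 := h.range_inj (strictMono_id (α := Fin m))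
      refine h2.1 ?_
      rw [Set.range_id]
      exact (Finite.injective_iff_surjective.1 h.injective).range_eq
    · rintro rfl
      exact strictMono_id
  rw [spread_apply, this, Finset.sum_singleton, ext0_id, push_id]

theorem spread_of_lt {m r : ℕ} (h : r < m) (x : ⨂[C]^(m + 1) A) : spread A m r x = 0 := by
  classical
  rw [spread_apply]
  refine Finset.sum_eq_zero fun f hf => ?_
  have := Fintype.card_le_of_injective f (Finset.mem_filter.1 hf).2.injective
  simp at this
  omega

theorem spread_mul (m n r : ℕ) (x : ⨂[C]^(m + 1) A) (y : ⨂[C]^(n + 1) A) :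
    spread A m r x * spread A n r y =
      ∑ s : MixShuffle m n, spread A s.len r (mixTerm C A s x y) := by
  classical
  simp only [spread_apply, Finset.sum_mul_sum]
  rw [MixShuffle.sum_pairs m n r fun f g => push C A (ext0 f) x * push C A (ext0 g) y]
  refine Finset.sum_congr rfl fun s _ => Finset.sum_congr rfl fun k _ => ?_
  rw [mixTerm_apply, map_mul, push_push, push_push, ext0_comp, ext0_comp]

/-- All `spread` maps together. -/
noncomputable def spreadAll (A : Type v) [CommRing A] [Algebra C A] (lam : C) (r : ℕ) :
    Sha C A lam →ₗ[C] ⨂[C]^(r + 1) A :=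
  DirectSum.toModule C ℕ _ fun m => spread A m r

theorem spreadAll_of (r m : ℕ) (x : ⨂[C]^(m + 1) A) :
    spreadAll A lam r (of A lam m x) = spread A m r x :=
  DirectSum.toModule_lof (R := C) (ι := ℕ) (M := fun k => ⨂[C]^(k + 1) A) m x

theorem spreadAll_eq_coeff (r : ℕ) (x : Sha C A lam) (h : ∀ k < r, coeff A lam k x = 0) :
    spreadAll A lam r x = coeff A lam r x := by
  classical
  have hx : x = ∑ i ∈ DFinsupp.support (β := fun k => ⨂[C]^(k + 1) A) x,
      of A lam i (coeff A lam i x) := (DirectSum.sum_support_of (β := fun k => ⨂[C]^(k + 1) A) x).symm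
  conv_lhs => rw [hx]
  conv_rhs => rw [hx]
  rw [map_sum, map_sum]
  refine Finset.sum_congr rfl fun i _ => ?_
  rw [spreadAll_of]
  rcases lt_trichotomy i r with hi | hi | hi
  · rw [h i hi, map_zero, map_zero, map_zero]
  · subst hi
    rw [spread_self, coeff_of_self]
  · rw [spread_of_lt hi, coeff_of_ne hi.ne']

theorem spreadAll_injective {x y : Sha C A lam}
    (h : ∀ r, spreadAll A lam r x = spreadAll A lam r y) : x = y := by
  rw [← sub_eq_zero]
  have h' : ∀ r, coeff A lam r (x - y) = 0 := by
    intro r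
    induction r using Nat.strong_induction_on with
    | _ r ih => rw [← spreadAll_eq_coeff r _ ih, map_sub, h, sub_self]
  exact ext_coeff fun r => by rw [h', map_zero]

theorem spreadAll_mul_one (r : ℕ) (x y : Sha C A (1 : C)) :
    spreadAll A 1 r (mulLin A 1 x y) = spreadAll A 1 r x * spreadAll A 1 r y := by
  induction x using induction with
  | h0 => simp
  | hadd x x' hx hx' => simp only [map_add, LinearMap.add_apply, hx, hx', add_mul]
  | hof m x =>
    induction y using induction with
    | h0 => simp
    | hadd y y' hy hy' => simp only [map_add, hy, hy', mul_add]
    | hof n y =>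
      rw [mulLin_of, homMul_apply, spreadAll_of, spreadAll_of, spread_mul, map_sum]
      simp only [one_pow, one_smul, spreadAll_of]

theorem mulLin_one_assoc (x y z : Sha C A (1 : C)) :
    mulLin A 1 (mulLin A 1 x y) z = mulLin A 1 x (mulLin A 1 y z) :=
  spreadAll_injective fun r => by simp only [spreadAll_mul_one, mul_assoc]

theorem mulLin_one_comm (x y : Sha C A (1 : C)) : mulLin A 1 x y = mulLin A 1 y x :=
  spreadAll_injective fun r => by simp only [spreadAll_mul_one, mul_comm]

theorem mulLin_one_one (x : Sha C A (1 : C)) : mulLin A 1 (of A 1 0 1) x = x :=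
  spreadAll_injective fun r => by
    classical
    have : (Finset.univ.filter fun f : Fin 0 → Fin r => StrictMono f) = {Fin.elim0} := by
      ext f
      simp only [Finset.mem_filter, Finset.mem_univ, true_and, Finset.mem_singleton]
      exact ⟨fun _ => Subsingleton.elim _ _, fun _ a => a.elim0⟩
    rw [spreadAll_mul_one, spreadAll_of, spread_apply, this, Finset.sum_singleton, map_one, one_mul]

/-! Passage from weight `1` to weight `λ`, degree by degree. -/

/-- The component of degree `r` of the product in weight `1`. -/
noncomputable def comp1 (m n r : ℕ) (x : ⨂[C]^(m + 1) A) (y : ⨂[C]^(n + 1) A) : ⨂[C]^(r + 1) A :=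
  coeff A 1 r (homMul A 1 m n x y)

theorem coeff_homMul (m n r : ℕ) (x : ⨂[C]^(m + 1) A) (y : ⨂[C]^(n + 1) A) :
    coeff A lam r (homMul A lam m n x y) = lam ^ (m + n - r) • comp1 m n r x y := by
  rw [comp1, homMul_apply, homMul_apply, map_sum, map_sum, Finset.smul_sum]
  refine Finset.sum_congr rfl fun s _ => ?_
  by_cases h : s.len = r
  · subst h
    have : s.merged.card ≤ m + n := by simpa using Finset.card_le_univ s.merged
    simp only [map_smul, one_pow, one_smul, coeff_of_self]
    rw [show m + n - s.len = s.merged.card by unfold MixShuffle.len; omega]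
  · simp only [map_smul, coeff_of_ne h, smul_zero]

theorem comp1_eq_zero {m n r : ℕ} (h : r < m ∨ r < n ∨ m + n < r) (x : ⨂[C]^(m + 1) A)
    (y : ⨂[C]^(n + 1) A) : comp1 m n r x y = 0 := by
  rw [comp1, homMul_apply, map_sum]
  refine Finset.sum_eq_zero fun s _ => ?_
  rw [map_smul, coeff_of_ne, smul_zero]
  rintro rfl
  have h1 := Fintype.card_le_of_injective s.left s.block_strictOnParts.1.injective
  have h2 := Fintype.card_le_of_injective s.right s.block_strictOnParts.2.injective
  simp only [Fintype.card_fin] at h1 h2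
  unfold MixShuffle.len at h h1 h2
  omega

theorem homMul_eq_sum (m n N : ℕ) (hN : m + n ≤ N) (x : ⨂[C]^(m + 1) A) (y : ⨂[C]^(n + 1) A) :
    homMul A lam m n x y =
      ∑ r ∈ Finset.range (N + 1), of A lam r (lam ^ (m + n - r) • comp1 m n r x y) := by
  ext k
  rw [map_sum, coeff_homMul]
  by_cases hk : k ∈ Finset.range (N + 1)
  · rw [Finset.sum_eq_single_of_mem k hk fun b _ hb => coeff_of_ne hb _, coeff_of_self]
  · rw [Finset.sum_eq_zero fun b hb => coeff_of_ne (by rintro rfl; exact hk hb) _]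
    rw [Finset.mem_range] at hk
    rw [comp1_eq_zero (by omega), smul_zero]

theorem comp1_smul (c : C) (m n r : ℕ) (x : ⨂[C]^(m + 1) A) (y : ⨂[C]^(n + 1) A) :
    comp1 m n r (c • x) y = c • comp1 m n r x y := by
  simp [comp1]

theorem comp1_zero_left (m n r : ℕ) (y : ⨂[C]^(n + 1) A) :
    comp1 m n r (0 : ⨂[C]^(m + 1) A) y = 0 := by
  simp [comp1]

theorem mulLin_comm (x y : Sha C A lam) : mulLin A lam x y = mulLin A lam y x := by
  induction x using induction with
  | h0 => simp
  | hadd x x' hx hx' => simp only [map_add, LinearMap.add_apply, hx, hx']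
  | hof m x =>
    induction y using induction with
    | h0 => simp
    | hadd y y' hy hy' => simp only [map_add, LinearMap.add_apply, hy, hy']
    | hof n y =>
      have h := mulLin_one_comm (of A 1 m x) (of A 1 n y)
      rw [mulLin_of, mulLin_of] at h ⊢
      ext r
      rw [coeff_homMul, coeff_homMul, comp1, comp1, h, Nat.add_comm n m]

theorem coeff_mul_mul (m n p r : ℕ) (x : ⨂[C]^(m + 1) A) (y : ⨂[C]^(n + 1) A)
    (z : ⨂[C]^(p + 1) A) :
    coeff A lam r (mulLin A lam (mulLin A lam (of A lam m x) (of A lam n y)) (of A lam p z)) =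
      lam ^ (m + n + p - r) • coeff A 1 r
        (mulLin A 1 (mulLin A 1 (of A 1 m x) (of A 1 n y)) (of A 1 p z)) := by
  simp only [mulLin_of, homMul_eq_sum m n (m + n) le_rfl, map_sum, LinearMap.sum_apply,
    coeff_homMul, Finset.smul_sum, comp1_smul, one_pow, one_smul]
  refine Finset.sum_congr rfl fun s hs => ?_
  rw [Finset.mem_range] at hs
  by_cases h : s + p < r
  · rw [comp1_eq_zero (by omega), smul_zero, smul_zero, smul_zero]
  · rw [smul_smul, ← pow_add]
    congr 2
    omega

theorem mulLin_assoc (x y z : Sha C A lam) :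
    mulLin A lam (mulLin A lam x y) z = mulLin A lam x (mulLin A lam y z) := by
  induction x using induction with
  | h0 => simp
  | hadd x x' hx hx' => simp only [map_add, LinearMap.add_apply, hx, hx']
  | hof m x =>
    induction y using induction with
    | h0 => simp
    | hadd y y' hy hy' => simp only [map_add, LinearMap.add_apply, hy, hy']
    | hof n y =>
      induction z using induction with
      | h0 => simp
      | hadd z z' hz hz' => simp only [map_add, hz, hz']
      | hof p z =>
        ext r
        rw [mulLin_comm (of A lam m x) (mulLin A lam _ _), coeff_mul_mul (lam := lam) m n p,
          coeff_mul_mul (lam := lam) n p m, mulLin_one_assoc, mulLin_one_comm (of A 1 m x) (mulLin A 1 _ _),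
          show n + p + m = m + n + p by omega]

theorem one_mulLin (x : Sha C A lam) : mulLin A lam (of A lam 0 1) x = x := by
  induction x using induction with
  | h0 => simp
  | hadd x x' hx hx' => simp only [map_add, hx, hx']
  | hof n x =>
    have h := mulLin_one_one (of A 1 n x)
    rw [mulLin_of] at h ⊢
    ext r
    rw [coeff_homMul, comp1, h]
    by_cases hr : n = r
    · subst hr
      simp [coeff_of_self]
    · rw [coeff_of_ne hr, coeff_of_ne hr, smul_zero]

noncomputable instance : CommRing (Sha C A lam) where
  __ := (inferInstance : AddCommGroup (Sha C A lam))
  mul x y := mulLin A lam x y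
  one := of A lam 0 1
  left_distrib x y z := map_add _ y z
  right_distrib x y z := LinearMap.map_add₂ _ x y z
  zero_mul x := LinearMap.map_zero₂ _ x
  mul_zero x := map_zero _
  mul_assoc := mulLin_assoc
  one_mul := one_mulLin
  mul_one x := (mulLin_comm x _).trans (one_mulLin x)
  mul_comm := mulLin_comm

theorem mul_def (x y : Sha C A lam) : x * y = mulLin A lam x y := rfl

theorem one_def : (1 : Sha C A lam) = of A lam 0 1 := rfl

noncomputable instance : Algebra C (Sha C A lam) :=
  Algebra.ofModule (fun c x y => LinearMap.map_smul₂ _ c x y) (fun c _ y => map_smul _ c y)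

/-- The embedding `j_A : A → Ш_C(A)` onto the summand of degree `0`, `a ↦ a ∈ A^{⊗ 1}`. -/
noncomputable def incl (A : Type v) [CommRing A] [Algebra C A] (lam : C) : A →ₗ[C] Sha C A lam :=
  of A lam 0 ∘ₗ
    (PiTensorProduct.subsingletonEquiv (R := C) (s := fun _ => A) (0 : Fin 1)).symm.toLinearMap

theorem incl_apply (a : A) :
    incl A lam a = of A lam 0 (PiTensorProduct.tprod C fun _ => a) := by
  refine congrArg (of A lam 0) ?_
  rw [LinearEquiv.coe_coe, LinearEquiv.symm_apply_eq]
  exact (PiTensorProduct.subsingletonEquiv_apply_tprod (R := C) (s := fun _ => A) (0 : Fin 1)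
    fun _ => a).symm

theorem coeff_mul_eq_zero (k : ℕ) (a x : Sha C A lam) (hx : ∀ n < k, coeff A lam n x = 0) :
    ∀ n < k, coeff A lam n (a * x) = 0 := by
  classical
  intro n hn
  have hs : x = ∑ i ∈ DFinsupp.support (β := fun k => ⨂[C]^(k + 1) A) x,
      of A lam i (coeff A lam i x) := (DirectSum.sum_support_of (β := fun k => ⨂[C]^(k + 1) A) x).symm
  rw [hs, mul_def, map_sum, map_sum]
  refine Finset.sum_eq_zero fun i _ => ?_
  by_cases hi : i < k
  · rw [hx i hi]
    simp
  · induction a using induction with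
    | h0 => simp
    | hadd a a' ha ha' => simp only [map_add, LinearMap.add_apply, ha, ha', add_zero]
    | hof m a => rw [mulLin_of, coeff_homMul, comp1_eq_zero (by omega), smul_zero]

variable (A lam) in
/-- `Fil^k Ш_C(A) = ⨁_{n ≥ k} A^{⊗ (n + 1)}`. -/
noncomputable def fil (k : ℕ) : Ideal (Sha C A lam) where
  carrier := {x | ∀ n < k, coeff A lam n x = 0}
  add_mem' hx hy n hn := by rw [map_add, hx n hn, hy n hn, add_zero]
  zero_mem' n _ := map_zero _
  smul_mem' a x hx := coeff_mul_eq_zero k a x hx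

theorem mem_fil {k : ℕ} {x : Sha C A lam} : x ∈ fil A lam k ↔ ∀ n < k, coeff A lam n x = 0 :=
  Iff.rfl

theorem fil_antitone : Antitone (fil A lam) := fun _ _ h _ hx n hn => hx n (hn.trans_le h)

end Sha

variable {C} in
/-- The complete shuffle algebra `lim_k Ш_C(A) / Fil^k Ш_C(A)`, as a subring of the product. (The
term `k = 0` of the inverse system is the zero ring and has no effect.) -/
def shaHatSubring (lam : C) : Subring (∀ k : ℕ, Sha C A lam ⧸ Sha.fil A lam k) where
  carrier := {x | ∀ k l : ℕ, ∀ h : k ≤ l, Ideal.Quotient.factor (Sha.fil_antitone h) (x l) = x k}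
  mul_mem' hx hy k l h := by rw [Pi.mul_apply, map_mul, hx k l h, hy k l h, Pi.mul_apply]
  one_mem' k l h := by rw [Pi.one_apply, map_one, Pi.one_apply]
  add_mem' hx hy k l h := by rw [Pi.add_apply, map_add, hx k l h, hy k l h, Pi.add_apply]
  zero_mem' k l h := by rw [Pi.zero_apply, map_zero, Pi.zero_apply]
  neg_mem' hx k l h := by rw [Pi.neg_apply, map_neg, hx k l h, Pi.neg_apply]

/-- The complete shuffle algebra `lim_k Ш_C(A) / Fil^k Ш_C(A)`. -/
abbrev ShaHat (lam : C) : Type (max u v) := shaHatSubring A lam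

namespace ShaHat

variable {C} {A} {lam : C}

/-- The component of degree `n` on `Ш_C(A) / Fil^k Ш_C(A)`, for `n < k`. -/
noncomputable def quotCoeff {n k : ℕ} (h : n < k) :
    (Sha C A lam ⧸ Sha.fil A lam k) →+ ⨂[C]^(n + 1) A :=
  QuotientAddGroup.lift (Sha.fil A lam k).toAddSubgroup
    (Sha.coeff A lam n).toAddMonoidHom (fun _ hx => hx n h)

theorem quotCoeff_mk {n k : ℕ} (h : n < k) (x : Sha C A lam) :
    quotCoeff h (Ideal.Quotient.mk (Sha.fil A lam k) x) = Sha.coeff A lam n x := rfl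

/-- The component of degree `n` of an element `x = (x^{(k)} + Fil^k)_k` of the complete shuffle
algebra: the degree `n` component of `x^{(k)}` for any `k > n`, for instance `k = n + 1`. The map
`x ↦ (n ↦ coeff n x)` is the identification of the completion with `∏_n A^{⊗ (n + 1)}`. -/
noncomputable def coeff (n : ℕ) : ShaHat C A lam →+ ⨂[C]^(n + 1) A :=
  (quotCoeff (Nat.lt_succ_self n)).comp
    ((Pi.evalAddMonoidHom (fun k : ℕ => Sha C A lam ⧸ Sha.fil A lam k) (n + 1)).comp
      (shaHatSubring A lam).subtype.toAddMonoidHom)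

theorem coeff_apply (n : ℕ) (x : ShaHat C A lam) :
    coeff n x = quotCoeff (Nat.lt_succ_self n) (x.1 (n + 1)) := rfl

theorem coeff_eq (n k : ℕ) (h : n < k) (x : ShaHat C A lam) : coeff n x = quotCoeff h (x.1 k) := by
  rw [coeff_apply, ← x.2 (n + 1) k h]
  obtain ⟨y, hy⟩ := Ideal.Quotient.mk_surjective (x.1 k)
  rw [← hy, Ideal.Quotient.factor_mk, quotCoeff_mk, quotCoeff_mk]

theorem coeff_bijective :
    Function.Bijective (fun (x : ShaHat C A lam) (n : ℕ) => coeff n x) := by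
  constructor
  · intro x y h
    refine Subtype.ext (funext fun k => ?_)
    obtain ⟨a, ha⟩ := Ideal.Quotient.mk_surjective (x.1 k)
    obtain ⟨b, hb⟩ := Ideal.Quotient.mk_surjective (y.1 k)
    rw [← ha, ← hb, Ideal.Quotient.eq]
    intro n hn
    have := congrFun h n
    simp only [coeff_eq n k hn, ← ha, ← hb, quotCoeff_mk] at this
    rw [map_sub, this, sub_self]
  · intro z
    let S : ℕ → Sha C A lam := fun k => ∑ i ∈ Finset.range k, Sha.of A lam i (z i)
    have hS : ∀ n k, n < k → Sha.coeff A lam n (S k) = z n := by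
      intro n k h
      simp only [S, map_sum]
      rw [Finset.sum_eq_single_of_mem n (Finset.mem_range.2 h) fun b _ hb => Sha.coeff_of_ne hb _,
        Sha.coeff_of_self]
    refine ⟨⟨fun k => Ideal.Quotient.mk _ (S k), fun k l h => ?_⟩, funext fun n => ?_⟩
    · rw [Ideal.Quotient.factor_mk, Ideal.Quotient.eq]
      intro n hn
      rw [map_sub, hS n l (hn.trans_le h), hS n k hn, sub_self]
    · exact hS n (n + 1) (Nat.lt_succ_self n)

end ShaHat

end Algebra

end BaxterShuffle

/-!
The operator `P x = 1 ⊗ x` is a Rota–Baxter operator. In weight `1` this is checked on the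
homomorphisms `Ш → A^{⊗ (r + 1)}` that sum a tensor over all strictly increasing ways of spreading
it over `r + 1` slots: they are jointly injective and turn `P` into partial summation. Weight `λ`
follows, since the component of degree `r` of a product of elements of degrees `m` and `n` is the
one in weight `1` multiplied by `λ ^ (m + n - r)`.

If `λ x² = μ x`, the Rota–Baxter identity telescopes `∏_{j < n} (P x - j μ)` to `n!` times the
nested power `P(x P(x ⋯))`, which vanishes in positive characteristic `q` for `n = q`. For `x = 1`
and `μ = λ` this is a vanishing product of nonzero factors `1 ⊗ 1 - j λ`; for `λ = μ = 0` it says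
that every `P x` is nilpotent, and a pure tensor `x₀ ⊗ x₁ ⊗ ⋯` is `x₀ P(x₁ ⊗ ⋯)`. When `λ` is
regular, the spreading homomorphisms, with `λ ^ m` inserted in degree `m`, exhibit each `Fil^k` as
an intersection of kernels of maps to tensor powers of `A`, hence as a radical ideal if those are
reduced.
-/

namespace BaxterShuffle

open scoped Nat

section RotaBaxter

variable {C R : Type*} [CommRing C] [CommRing R] [Algebra C R] {lam mu : C} {P : R →ₗ[C] R}

/-- Rota–Baxter operators of weight `lam`, an algebraic form of integration (`lam = 0`) and of
summation (`lam = 1`). -/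
def IsRotaBaxter (lam : C) (P : R →ₗ[C] R) : Prop :=
  ∀ x y, P x * P y = P (x * P y + P x * y + lam • (x * y))

/-- The iterated integral `P(x P(x ⋯ P(x)))` with `n` applications of `P`; in weight zero it is the
divided power of `P x`. -/
def nestedPow (P : R →ₗ[C] R) (x : R) : ℕ → R
  | 0 => 1
  | n + 1 => P (x * nestedPow P x n)

namespace IsRotaBaxter

theorem mul_nestedPow (hP : IsRotaBaxter lam P) {x : R} (hx : lam • (x * x) = mu • x) (n : ℕ) :
    P x * nestedPow P x n =
      (n + 1) • nestedPow P x (n + 1) + (n • mu) • nestedPow P x n := by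
  induction n with
  | zero => simp [nestedPow]
  | succ n ih =>
    have h_left : P x * (x * nestedPow P x n) =
        (n + 1) • (x * nestedPow P x (n + 1)) + (n • mu) • (x * nestedPow P x n) := by
      rw [mul_left_comm, ih, mul_add, mul_smul_comm, mul_smul_comm]
    have h_diag : lam • (x * (x * nestedPow P x n)) = mu • (x * nestedPow P x n) := by
      rw [← mul_assoc, ← smul_mul_assoc, hx, smul_mul_assoc]
    calc P x * P (x * nestedPow P x n)
        = P ((n + 2) • (x * nestedPow P x (n + 1)) +
            ((n + 1) • mu) • (x * nestedPow P x n)) := by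
          rw [hP, h_left, h_diag, ← nestedPow]
          congr 1
          module
      _ = (n + 2) • nestedPow P x (n + 2) + ((n + 1) • mu) • nestedPow P x (n + 1) := by
          rw [map_add, map_nsmul, map_smul, ← nestedPow, ← nestedPow]

theorem prod_sub_smul_one (hP : IsRotaBaxter lam P) {x : R} (hx : lam • (x * x) = mu • x)
    (n : ℕ) : ∏ j ∈ Finset.range n, (P x - (j • mu) • 1) = n ! • nestedPow P x n := by
  induction n with
  | zero => simp [nestedPow]
  | succ n ih =>
    rw [Finset.prod_range_succ, ih, smul_mul_assoc, mul_sub, mul_comm, hP.mul_nestedPow hx,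
      mul_smul_comm, mul_one, add_sub_cancel_right, smul_smul, mul_comm, Nat.factorial_succ]

theorem prod_sub_smul_one_eq_zero (hP : IsRotaBaxter lam P) {x : R}
    (hx : lam • (x * x) = mu • x) {n : ℕ} (hn : (n ! : R) = 0) :
    ∏ j ∈ Finset.range n, (P x - (j • mu) • 1) = 0 := by
  rw [hP.prod_sub_smul_one hx, nsmul_eq_mul, hn, zero_mul]

theorem isNilpotent_apply (hP : IsRotaBaxter (0 : C) P) (x : R) {n : ℕ} (hn : (n ! : R) = 0) :
    IsNilpotent (P x) := by
  have h := hP.prod_sub_smul_one_eq_zero (mu := 0) (x := x) (by simp only [zero_smul]) hn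
  simp only [smul_zero, zero_smul, sub_zero, Finset.prod_const, Finset.card_range] at h
  exact ⟨n, h⟩

end IsRotaBaxter

end RotaBaxter

section StrictMono

variable {m r : ℕ}

theorem ext0_comp_succ (f : Fin m → Fin r) : ext0 f ∘ Fin.succ = Fin.succ ∘ f := rfl

theorem ext0_injective : Function.Injective (ext0 : (Fin m → Fin r) → Fin (m + 1) → Fin (r + 1)) :=
  fun _ _ h => (Fin.succ_injective r).comp_left ((Fin.cons_injective2 h).2)

theorem strictMono_succ_comp_iff {f : Fin m → Fin r} :
    StrictMono (Fin.succ ∘ f) ↔ StrictMono f :=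
  ⟨fun h _ _ hij => Fin.succ_lt_succ_iff.1 (h hij), fun h => Fin.strictMono_succ.comp h⟩

theorem strictMono_ext0_iff {f : Fin m → Fin r} : StrictMono (ext0 f) ↔ StrictMono f := by
  rw [ext0, Fin.strictMono_cons]
  simp only [Fin.succ_pos, implies_true, true_and]
  exact strictMono_succ_comp_iff

theorem exists_succ_comp_eq {f : Fin m → Fin (r + 1)} (hf : ∀ i, f i ≠ 0) :
    ∃ g : Fin m → Fin r, Fin.succ ∘ g = f := by
  choose g hg using fun i => Fin.exists_succ_eq_of_ne_zero (hf i)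
  exact ⟨g, funext hg⟩

theorem exists_ext0_eq {f : Fin (m + 1) → Fin (r + 1)} (hf : StrictMono f) (h0 : f 0 = 0) :
    ∃ g : Fin m → Fin r, ext0 g = f := by
  obtain ⟨g, hg⟩ := exists_succ_comp_eq (f := f ∘ Fin.succ)
    fun i => ((Fin.zero_le _).trans_lt (hf (Fin.succ_pos i))).ne'
  refine ⟨g, funext (Fin.cases h0.symm fun i => congrFun hg i)⟩

open Classical in
theorem sum_strictMono_succ {M : Type*} [AddCommMonoid M]
    (F : (Fin (m + 1) → Fin (r + 1)) → M) :
    ∑ f with StrictMono f, F f =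
      (∑ g : Fin m → Fin r with StrictMono g, F (ext0 g)) +
        ∑ g : Fin (m + 1) → Fin r with StrictMono g, F (Fin.succ ∘ g) := by
  rw [← Finset.sum_filter_add_sum_filter_not _ fun f => f 0 = 0, Finset.filter_filter,
    Finset.filter_filter]
  congr 1 <;> symm
  · refine Finset.sum_nbij ext0 (fun g hg => ?_) ext0_injective.injOn (fun f hf => ?_)
      fun _ _ => rfl
    · simp only [Finset.mem_filter, Finset.mem_univ, true_and] at hg ⊢
      exact ⟨strictMono_ext0_iff.2 hg, rfl⟩
    · obtain ⟨hf, h0⟩ : StrictMono f ∧ f 0 = 0 := by simpa using hf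
      obtain ⟨g, rfl⟩ := exists_ext0_eq hf h0
      exact ⟨g, by simpa [strictMono_ext0_iff] using hf, rfl⟩
  · refine Finset.sum_nbij (Fin.succ ∘ ·) (fun g hg => ?_)
      (Fin.succ_injective r).comp_left.injOn (fun f hf => ?_) fun _ _ => rfl
    · simpa [strictMono_succ_comp_iff] using hg
    · obtain ⟨hf, h0⟩ : StrictMono f ∧ f 0 ≠ 0 := by simpa using hf
      obtain ⟨g, rfl⟩ := exists_succ_comp_eq fun i =>
        ((Fin.pos_of_ne_zero h0).trans_le (hf.monotone (Fin.zero_le i))).ne'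
      exact ⟨g, by simpa [strictMono_succ_comp_iff] using hf, rfl⟩

end StrictMono

section TensorPower

variable (C A : Type*) [CommRing C] [CommRing A] [Algebra C A]

/-- The identification of `A` with its first tensor power, `a ↦ ⨂ a`. -/
noncomputable def tensorPowerOneEquiv : A ≃ₐ[C] ⨂[C]^1 A :=
  AlgEquiv.ofLinearEquiv
    (PiTensorProduct.subsingletonEquiv (R := C) (s := fun _ => A) (0 : Fin 1)).symm
    (PiTensorProduct.subsingletonEquiv_symm_apply' _ _)
    fun a b => by
      simp only [PiTensorProduct.subsingletonEquiv_symm_apply', PiTensorProduct.tprod_mul_tprod]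
      rfl

theorem tensorPowerOneEquiv_apply (a : A) :
    tensorPowerOneEquiv C A a = PiTensorProduct.tprod C fun _ => a :=
  PiTensorProduct.subsingletonEquiv_symm_apply' _ _

instance nontrivial_tensorPower [Nontrivial A] (k : ℕ) : Nontrivial (⨂[C]^k A) :=
  ((tensorPowerOneEquiv C A).symm.toAlgHom.comp
    (push C A fun _ : Fin k => (0 : Fin 1))).toRingHom.domain_nontrivial

end TensorPower

namespace Sha

variable {C A : Type*} [CommRing C] [CommRing A] [Algebra C A] {lam : C}

theorem exists_eq_sum_of_coeff (x : Sha C A lam) :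
    ∃ s : Finset ℕ, x = ∑ i ∈ s, of A lam i (coeff A lam i x) := by
  classical
  exact ⟨DFinsupp.support (β := fun k => ⨂[C]^(k + 1) A) x,
    (DirectSum.sum_support_of (β := fun k => ⨂[C]^(k + 1) A) x).symm⟩

theorem eq_zero_of_forall_mem_fil {x : Sha C A lam} (h : ∀ k, x ∈ fil A lam k) : x = 0 :=
  ext_coeff fun n => by rw [h (n + 1) n n.lt_succ_self, map_zero]

theorem coeff_of_mul_of (m n r : ℕ) (x : ⨂[C]^(m + 1) A) (y : ⨂[C]^(n + 1) A) :
    coeff A lam r (of A lam m x * of A lam n y) =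
      lam ^ (m + n - r) • coeff A 1 r (of A 1 m x * of A 1 n y) := by
  rw [mul_def, mul_def, mulLin_of, mulLin_of, coeff_homMul, comp1]

theorem coeff_of_mul_of_eq_zero {m n r : ℕ} (h : r < m ∨ r < n ∨ m + n < r)
    (x : ⨂[C]^(m + 1) A) (y : ⨂[C]^(n + 1) A) :
    coeff A lam r (of A lam m x * of A lam n y) = 0 := by
  rw [mul_def, mulLin_of, coeff_homMul, comp1_eq_zero h, smul_zero]

/-! ### Spreading homomorphisms -/

theorem spread_zero_left (r : ℕ) (a : ⨂[C]^(0 + 1) A) :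
    spread A 0 r a = push C A (ext0 Fin.elim0) a := by
  classical
  rw [spread_apply, Finset.filter_true_of_mem fun f _ => Subsingleton.strictMono f,
    Fintype.sum_unique, Subsingleton.elim default Fin.elim0]

variable (A lam) in
/-- The linear map underlying `spreadHom`. -/
noncomputable def spreadLin (r : ℕ) : Sha C A lam →ₗ[C] ⨂[C]^(r + 1) A :=
  DirectSum.toModule C ℕ _ fun m => lam ^ m • spread A m r

theorem spreadLin_of (r m : ℕ) (x : ⨂[C]^(m + 1) A) :
    spreadLin A lam r (of A lam m x) = lam ^ m • spread A m r x :=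
  DirectSum.toModule_lof (R := C) (ι := ℕ) (M := fun k => ⨂[C]^(k + 1) A) m x

theorem spreadLin_one (r : ℕ) : spreadLin A lam r 1 = 1 := by
  rw [one_def, spreadLin_of, spread_zero_left, map_one, pow_zero, one_smul]

theorem spreadLin_of_mul_of (r m n : ℕ) (x : ⨂[C]^(m + 1) A) (y : ⨂[C]^(n + 1) A) :
    spreadLin A lam r (of A lam m x * of A lam n y) =
      spreadLin A lam r (of A lam m x) * spreadLin A lam r (of A lam n y) := by
  rw [mul_def, mulLin_of, homMul_apply, spreadLin_of, spreadLin_of, smul_mul_smul_comm, spread_mul,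
    map_sum, Finset.smul_sum]
  refine Finset.sum_congr rfl fun s _ => ?_
  have h_exp : s.merged.card + s.len = m + n :=
    Nat.add_sub_cancel' (by simpa using Finset.card_le_univ s.merged)
  rw [map_smul, spreadLin_of, smul_smul, ← pow_add, ← pow_add, h_exp]

theorem spreadLin_mul (r : ℕ) (x y : Sha C A lam) :
    spreadLin A lam r (x * y) = spreadLin A lam r x * spreadLin A lam r y := by
  induction x using induction with
  | h0 => simp only [zero_mul, map_zero]
  | hadd x x' hx hx' => simp only [map_add, add_mul, hx, hx']
  | hof m x =>
    induction y using induction with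
    | h0 => simp only [mul_zero, map_zero]
    | hadd y y' hy hy' => simp only [map_add, mul_add, hy, hy']
    | hof n y => exact spreadLin_of_mul_of r m n x y

variable (A lam) in
/-- The algebra homomorphism to the `(r + 1)`-st tensor power that multiplies a tensor of degree `m`
by `lam ^ m` and sums over the strictly increasing ways of spreading its last `m` factors over the
last `r` slots. The factor `lam ^ m` is what makes it multiplicative in weight `lam`. -/
noncomputable def spreadHom (r : ℕ) : Sha C A lam →ₐ[C] ⨂[C]^(r + 1) A :=
  AlgHom.ofLinearMap (spreadLin A lam r) (spreadLin_one r) (spreadLin_mul r)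

theorem spreadHom_of (r m : ℕ) (x : ⨂[C]^(m + 1) A) :
    spreadHom A lam r (of A lam m x) = lam ^ m • spread A m r x :=
  spreadLin_of r m x

theorem spreadHom_eq_coeff {r : ℕ} {x : Sha C A lam} (h : x ∈ fil A lam r) :
    spreadHom A lam r x = lam ^ r • coeff A lam r x := by
  obtain ⟨s, hs⟩ := exists_eq_sum_of_coeff x
  conv_lhs => rw [hs]
  conv_rhs => rw [hs]
  rw [map_sum, map_sum, Finset.smul_sum]
  refine Finset.sum_congr rfl fun i _ => ?_
  rw [spreadHom_of]
  rcases lt_trichotomy i r with hi | rfl | hi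
  · rw [h i hi, map_zero, map_zero, map_zero, smul_zero, smul_zero]
  · rw [spread_self, coeff_of_self]
  · rw [spread_of_lt hi, coeff_of_ne hi.ne', smul_zero, smul_zero]

theorem spreadHom_zero (x : Sha C A lam) : spreadHom A lam 0 x = coeff A lam 0 x := by
  rw [spreadHom_eq_coeff fun k hk => absurd hk k.not_lt_zero, pow_zero, one_smul]

theorem mem_fil_iff_spreadHom (hlam : ∀ n, IsSMulRegular (⨂[C]^(n + 1) A) lam) {k : ℕ}
    {x : Sha C A lam} : x ∈ fil A lam k ↔ ∀ n < k, spreadHom A lam n x = 0 := by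
  refine ⟨fun hx n hn => ?_, fun hx n hn => ?_⟩
  · rw [spreadHom_eq_coeff (fil_antitone hn.le hx), hx n hn, smul_zero]
  · induction n using Nat.strong_induction_on with
    | _ n ih =>
      have h_eq := spreadHom_eq_coeff fun j hj => ih j hj (hj.trans hn)
      exact ((hlam n).pow n).right_eq_zero_of_smul (h_eq.symm.trans (hx n hn))

theorem eq_of_forall_spreadHom_eq {x y : Sha C A (1 : C)}
    (h : ∀ r, spreadHom A 1 r x = spreadHom A 1 r y) : x = y :=
  sub_eq_zero.1 <| eq_zero_of_forall_mem_fil fun _ =>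
    (mem_fil_iff_spreadHom fun _ => IsSMulRegular.one _).2 fun r _ => by
      rw [map_sub, h r, sub_self]

theorem fil_isRadical (hlam : ∀ n, IsSMulRegular (⨂[C]^(n + 1) A) lam)
    (hred : ∀ n, IsReduced (⨂[C]^(n + 1) A)) (k : ℕ) : (fil A lam k).IsRadical := by
  rintro x ⟨N, hN⟩
  rw [mem_fil_iff_spreadHom hlam] at hN ⊢
  intro n hn
  have := hred n
  exact eq_zero_of_pow_eq_zero ((map_pow _ _ _).symm.trans (hN n hn))

/-! ### The Baxter operator -/

variable (A lam) in
/-- The Baxter operator `x ↦ 1 ⊗ x`. -/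
noncomputable def baxter : Sha C A lam →ₗ[C] Sha C A lam :=
  DirectSum.toModule C ℕ _ fun m => of A lam (m + 1) ∘ₗ (push C A Fin.succ).toLinearMap

theorem baxter_of (m : ℕ) (x : ⨂[C]^(m + 1) A) :
    baxter A lam (of A lam m x) = of A lam (m + 1) (push C A Fin.succ x) :=
  DirectSum.toModule_lof (R := C) (ι := ℕ) (M := fun k => ⨂[C]^(k + 1) A) m x

theorem coeff_zero_baxter (x : Sha C A lam) : coeff A lam 0 (baxter A lam x) = 0 := by
  induction x using induction with
  | h0 => simp only [map_zero]
  | hadd x y hx hy => rw [map_add, map_add, hx, hy, add_zero]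
  | hof m x => rw [baxter_of, coeff_of_ne m.succ_ne_zero]

theorem coeff_succ_baxter (r : ℕ) (x : Sha C A lam) :
    coeff A lam (r + 1) (baxter A lam x) = push C A Fin.succ (coeff A lam r x) := by
  induction x using induction with
  | h0 => simp only [map_zero]
  | hadd x y hx hy => simp only [map_add, hx, hy]
  | hof m x =>
    rw [baxter_of]
    obtain rfl | h := eq_or_ne m r
    · rw [coeff_of_self, coeff_of_self]
    · rw [coeff_of_ne h, coeff_of_ne (Nat.succ_injective.ne h), map_zero]

theorem spread_push_succ (m r : ℕ) (x : ⨂[C]^(m + 1) A) :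
    spread A (m + 1) (r + 1) (push C A Fin.succ x) =
      push C A Fin.succ (spread A m r x + spread A (m + 1) r (push C A Fin.succ x)) := by
  classical
  simp only [spread_apply, push_push, map_add, map_sum, ext0_comp_succ]
  exact sum_strictMono_succ fun f => push C A (Fin.succ ∘ f) x

theorem spreadHom_zero_baxter (x : Sha C A lam) : spreadHom A lam 0 (baxter A lam x) = 0 := by
  rw [spreadHom_zero, coeff_zero_baxter]

theorem spreadHom_succ_baxter (r : ℕ) (x : Sha C A lam) :
    spreadHom A lam (r + 1) (baxter A lam x) =
      push C A Fin.succ (lam • spreadHom A lam r x + spreadHom A lam r (baxter A lam x)) := by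
  induction x using induction with
  | h0 => simp only [map_zero, smul_zero, add_zero]
  | hadd x y hx hy => simp only [map_add, smul_add, hx, hy]; abel
  | hof m x =>
    simp only [baxter_of, spreadHom_of, spread_push_succ, map_add, map_smul, smul_smul, smul_add,
      pow_succ']

theorem spreadHom_baxter_mul_baxter (r : ℕ) (x y : Sha C A lam) :
    spreadHom A lam r (baxter A lam x * baxter A lam y) = spreadHom A lam r
      (baxter A lam (x * baxter A lam y + baxter A lam x * y + lam • (x * y))) := by
  induction r with
  | zero => simp only [map_mul, spreadHom_zero_baxter, zero_mul]
  | succ r ih =>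
    rw [map_mul, spreadHom_succ_baxter, spreadHom_succ_baxter, spreadHom_succ_baxter, ← ih,
      ← map_mul]
    simp only [map_add, map_mul, map_smul]
    simp only [Algebra.smul_def]
    ring

theorem isRotaBaxter_baxter_one : IsRotaBaxter (1 : C) (baxter A (1 : C)) := fun x y =>
  eq_of_forall_spreadHom_eq fun r => spreadHom_baxter_mul_baxter r x y

theorem baxter_of_mul_baxter_of (m n : ℕ) (x : ⨂[C]^(m + 1) A) (y : ⨂[C]^(n + 1) A) :
    baxter A lam (of A lam m x) * baxter A lam (of A lam n y) =
      baxter A lam (of A lam m x * baxter A lam (of A lam n y) +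
        baxter A lam (of A lam m x) * of A lam n y + lam • (of A lam m x * of A lam n y)) := by
  have h_one := isRotaBaxter_baxter_one (of A 1 m x) (of A 1 n y)
  simp only [baxter_of] at h_one ⊢
  refine ext_coeff fun r => ?_
  cases r with
  | zero => rw [coeff_of_mul_of_eq_zero (.inl m.succ_pos), coeff_zero_baxter]
  | succ r =>
    rw [coeff_of_mul_of, h_one, coeff_succ_baxter, coeff_succ_baxter, ← map_smul]
    simp only [map_add, map_smul, coeff_of_mul_of (lam := lam), one_smul, smul_add]
    have h_exp_left : m + 1 + (n + 1) - (r + 1) = m + (n + 1) - r := by omega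
    have h_exp_right : m + 1 + n - r = m + (n + 1) - r := by omega
    rw [h_exp_left, h_exp_right]
    by_cases hr : r ≤ m + n
    · have h_exp_diag : m + (n + 1) - r = m + n - r + 1 := by omega
      rw [smul_smul lam, ← pow_succ', h_exp_diag]
    · rw [coeff_of_mul_of_eq_zero (m := m) (n := n) (by omega)]
      simp only [map_zero, smul_zero]

theorem isRotaBaxter_baxter : IsRotaBaxter lam (baxter A lam) := by
  intro x y
  induction x using induction with
  | h0 => simp only [map_zero, zero_mul, smul_zero, add_zero]
  | hadd x x' hx hx' => simp only [map_add, add_mul, smul_add, hx, hx']; abel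
  | hof m x =>
    induction y using induction with
    | h0 => simp only [map_zero, mul_zero, smul_zero, add_zero]
    | hadd y y' hy hy' => simp only [map_add, mul_add, smul_add, hy, hy']; abel
    | hof n y => exact baxter_of_mul_baxter_of m n x y

theorem baxter_one_sub_smul_one_ne_zero [Nontrivial A] (c : C) :
    baxter A lam 1 - c • 1 ≠ 0 := fun h => by
  have h_coeff : coeff A lam 1 (baxter A lam 1 - c • 1) = 1 := by
    rw [map_sub, map_smul, coeff_succ_baxter, one_def, coeff_of_self, coeff_of_ne zero_ne_one,
      map_one, smul_zero, sub_zero]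
  rw [h, map_zero] at h_coeff
  exact zero_ne_one h_coeff

/-! ### The component of degree zero -/

theorem of_zero_mul_of_one (n : ℕ) (a : ⨂[C]^(0 + 1) A) (x : ⨂[C]^(n + 1) A) :
    of A (1 : C) 0 a * of A 1 n x = of A 1 n (push C A (ext0 Fin.elim0) a * x) := by
  refine eq_of_forall_spreadHom_eq fun r => ?_
  simp only [map_mul, spreadHom_of, one_pow, one_smul, spread_zero_left]
  simp only [spread_apply, Finset.mul_sum]
  refine Finset.sum_congr rfl fun f _ => ?_
  rw [map_mul, push_push, ← ext0_comp, Subsingleton.elim (f ∘ Fin.elim0) Fin.elim0]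

theorem of_zero_mul_of (n : ℕ) (a : ⨂[C]^(0 + 1) A) (x : ⨂[C]^(n + 1) A) :
    of A lam 0 a * of A lam n x = of A lam n (push C A (ext0 Fin.elim0) a * x) := by
  refine ext_coeff fun r => ?_
  rw [coeff_of_mul_of, of_zero_mul_of_one]
  obtain rfl | h := eq_or_ne n r
  · rw [coeff_of_self, coeff_of_self, zero_add, Nat.sub_self, pow_zero, one_smul]
  · rw [coeff_of_ne h, coeff_of_ne h, smul_zero]

theorem push_head_mul_push_tail (n : ℕ) (x : Fin (n + 1 + 1) → A) :
    push C A (ext0 (Fin.elim0 : Fin 0 → Fin (n + 1))) (PiTensorProduct.tprod C fun _ => x 0) *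
      push C A Fin.succ (PiTensorProduct.tprod C (Fin.tail x)) = PiTensorProduct.tprod C x := by
  rw [push_tprod, push_tprod, PiTensorProduct.tprod_mul_tprod]
  congr 1
  funext j
  simp only [Pi.mul_apply, Finset.prod_filter]
  refine Fin.cases ?_ (fun j => ?_) j
  · simp [ext0, Fin.succ_ne_zero]
  · simp [ext0, (Fin.succ_ne_zero j).symm, Fin.tail, Fin.succ_inj]

theorem of_tprod_succ (n : ℕ) (x : Fin (n + 1 + 1) → A) :
    of A lam (n + 1) (PiTensorProduct.tprod C x) =
      incl A lam (x 0) * baxter A lam (of A lam n (PiTensorProduct.tprod C (Fin.tail x))) := by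
  rw [incl_apply, baxter_of, of_zero_mul_of, push_head_mul_push_tail]

theorem incl_eq_of (a : A) : incl A lam a = of A lam 0 (tensorPowerOneEquiv C A a) := by
  rw [incl_apply, tensorPowerOneEquiv_apply]

theorem incl_mul (a b : A) : incl A lam (a * b) = incl A lam a * incl A lam b := by
  rw [incl_eq_of, incl_eq_of, incl_eq_of, of_zero_mul_of, map_mul,
    Subsingleton.elim (Fin.elim0 : Fin 0 → Fin 0) id, ext0_id, push_id]

variable (A lam) in
/-- `incl` as an algebra homomorphism. -/
noncomputable def inclHom : A →ₐ[C] Sha C A lam :=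
  AlgHom.ofLinearMap (incl A lam) (by rw [incl_eq_of, map_one, one_def]) incl_mul

variable (A lam) in
/-- The augmentation: the component of degree zero, as an element of `A`. -/
noncomputable def aug : Sha C A lam →ₐ[C] A :=
  (tensorPowerOneEquiv C A).symm.toAlgHom.comp (spreadHom A lam 0)

theorem coeff_zero_eq (x : Sha C A lam) :
    coeff A lam 0 x = tensorPowerOneEquiv C A (aug A lam x) :=
  (spreadHom_zero x).symm.trans ((tensorPowerOneEquiv C A).apply_symm_apply _).symm

theorem aug_incl (a : A) : aug A lam (incl A lam a) = a :=
  (tensorPowerOneEquiv C A).injective <| by rw [← coeff_zero_eq, incl_eq_of, coeff_of_self]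

theorem mem_fil_one_iff {x : Sha C A lam} : x ∈ fil A lam 1 ↔ aug A lam x = 0 := by
  rw [mem_fil, ← EmbeddingLike.map_eq_zero_iff (f := tensorPowerOneEquiv C A), ← coeff_zero_eq]
  exact ⟨fun h => h 0 one_pos, fun h n hn => Nat.lt_one_iff.1 hn ▸ h⟩

theorem disjoint_map_incl_fil_one (S : Submodule C A) :
    Disjoint (S.map (incl A lam)) ((fil A lam 1).restrictScalars C) := by
  rw [Submodule.disjoint_def]
  rintro _ ⟨a, -, rfl⟩ ha
  rw [← aug_incl (lam := lam) a, mem_fil_one_iff.1 ha, map_zero]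

/-! ### Zero divisors and nilpotents -/

theorem natCast_eq_zero {n : ℕ} (h : (n : A) = 0) : (n : Sha C A lam) = 0 := by
  rw [← map_natCast (inclHom A lam), h, map_zero]

theorem not_isDomain [Nontrivial A] {n : ℕ} (hn : (n ! : A) = 0) : ¬ IsDomain (Sha C A lam) :=
  fun _ => by
    have h_prod := isRotaBaxter_baxter.prod_sub_smul_one_eq_zero (x := (1 : Sha C A lam))
      (by rw [mul_one]) (natCast_eq_zero hn)
    obtain ⟨j, -, hj⟩ := Finset.prod_eq_zero_iff.1 h_prod
    exact baxter_one_sub_smul_one_ne_zero _ hj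

theorem not_isReduced_of_weight_zero [Nontrivial A] {n : ℕ} (hn : (n ! : A) = 0) :
    ¬ IsReduced (Sha C A (0 : C)) := fun _ => by
  have h_zero : baxter A (0 : C) 1 = 0 :=
    (isRotaBaxter_baxter.isNilpotent_apply _ (natCast_eq_zero hn)).eq_zero
  exact baxter_one_sub_smul_one_ne_zero (0 : C) (by rw [h_zero, zero_smul, sub_zero])

theorem of_succ_mem_nilradical {n : ℕ} (hn : (n ! : A) = 0) (k : ℕ) (x : ⨂[C]^(k + 1 + 1) A) :
    of A (0 : C) (k + 1) x ∈ (nilradical (Sha C A (0 : C))).restrictScalars C := by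
  induction x using PiTensorProduct.induction_on with
  | smul_tprod c x =>
    rw [map_smul, of_tprod_succ]
    exact Submodule.smul_mem _ c <| Ideal.mul_mem_left _ _ <| mem_nilradical.2 <|
      isRotaBaxter_baxter.isNilpotent_apply _ (natCast_eq_zero hn)
  | add x y hx hy =>
    rw [map_add]
    exact Submodule.add_mem _ hx hy

theorem fil_one_le_nilradical {n : ℕ} (hn : (n ! : A) = 0) :
    fil A (0 : C) 1 ≤ nilradical (Sha C A (0 : C)) := by
  intro x hx
  obtain ⟨s, hs⟩ := exists_eq_sum_of_coeff x
  rw [hs]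
  refine Ideal.sum_mem _ fun i _ => ?_
  cases i with
  | zero => rw [hx 0 one_pos, map_zero]; exact Ideal.zero_mem _
  | succ k => exact of_succ_mem_nilradical hn k _

theorem nilradical_eq_of_weight_zero {n : ℕ} (hn : (n ! : A) = 0) :
    (nilradical (Sha C A (0 : C))).restrictScalars C =
      ((nilradical A).restrictScalars C).map (incl A (0 : C)) ⊔
        (fil A (0 : C) 1).restrictScalars C := by
  refine le_antisymm (fun x hx => ?_) (sup_le ?_ fun x hx => fil_one_le_nilradical hn hx)
  · have h_aug : aug A 0 x ∈ nilradical A :=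
      mem_nilradical.2 ((mem_nilradical.1 hx).map (aug A (0 : C)))
    have h_sub : x - incl A 0 (aug A 0 x) ∈ fil A (0 : C) 1 := by
      rw [mem_fil_one_iff, map_sub, aug_incl, sub_self]
    exact Submodule.mem_sup.2
      ⟨_, Submodule.mem_map_of_mem h_aug, _, h_sub, add_sub_cancel _ _⟩
  · rintro _ ⟨a, ha, rfl⟩
    exact mem_nilradical.2 ((mem_nilradical.1 ha).map (inclHom A (0 : C)))

end Sha

namespace ShaHat

variable {C A : Type*} [CommRing C] [CommRing A] [Algebra C A] {lam : C}

variable (A lam) in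
/-- The canonical map to the completion. -/
noncomputable def ofSha : Sha C A lam →+* ShaHat C A lam :=
  (RingHom.pi fun k => Ideal.Quotient.mk (Sha.fil A lam k)).codRestrict (shaHatSubring A lam)
    fun _ _ _ _ => rfl

theorem ofSha_injective : Function.Injective (ofSha A lam) := by
  rw [injective_iff_map_eq_zero]
  intro x hx
  exact Sha.eq_zero_of_forall_mem_fil fun k =>
    Ideal.Quotient.eq_zero_iff_mem.1 (congrFun (congrArg Subtype.val hx) k)

variable (A lam) in
/-- The augmentation of the completion: the component of degree zero, as an element of `A`. -/
noncomputable def aug : ShaHat C A lam →+* A :=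
  (Ideal.Quotient.lift (Sha.fil A lam 1) (Sha.aug A lam : Sha C A lam →+* A)
    fun _ hx => Sha.mem_fil_one_iff.1 hx).comp
      ((Pi.evalRingHom _ 1).comp (shaHatSubring A lam).subtype)

theorem coeff_zero_eq (x : ShaHat C A lam) :
    coeff 0 x = tensorPowerOneEquiv C A (aug A lam x) := by
  obtain ⟨y, hy⟩ := Ideal.Quotient.mk_surjective (x.1 1)
  have h_aug : aug A lam x = Sha.aug A lam y :=
    (congrArg (Ideal.Quotient.lift (Sha.fil A lam 1) (Sha.aug A lam : Sha C A lam →+* A)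
      fun _ hx => Sha.mem_fil_one_iff.1 hx) hy).symm
  rw [coeff_eq 0 1 one_pos, ← hy, quotCoeff_mk, h_aug, Sha.coeff_zero_eq]

theorem exists_mem_nilradical_coeff_zero_eq {x : ShaHat C A lam}
    (hx : x ∈ nilradical (ShaHat C A lam)) :
    ∃ a ∈ nilradical A, coeff 0 x = PiTensorProduct.tprod C fun _ => a :=
  ⟨aug A lam x, mem_nilradical.2 ((mem_nilradical.1 hx).map (aug A lam)),
    (coeff_zero_eq x).trans (tensorPowerOneEquiv_apply C A _)⟩

theorem isReduced_of_fil_isRadical (h : ∀ k, (Sha.fil A lam k).IsRadical) :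
    IsReduced (ShaHat C A lam) := by
  have h_quot k : IsReduced (Sha C A lam ⧸ Sha.fil A lam k) :=
    (Ideal.isRadical_iff_quotient_reduced _).1 (h k)
  exact isReduced_of_injective (shaHatSubring A lam).subtype Subtype.val_injective

end ShaHat

end BaxterShuffle

open BaxterShuffle in
theorem mainTheorem3_general {C : Type*} [CommRing C] {A : Type*} [CommRing A] [Nontrivial A]
    [Algebra C A] (q : ℕ) [CharP A q] (hq : 0 < q) (lam : C) :
    (¬ IsDomain (Sha C A lam) ∧ ¬ IsDomain (ShaHat C A lam)) ∧
    (lam = 0 →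
      ¬ IsReduced (Sha C A lam) ∧ ¬ IsReduced (ShaHat C A lam) ∧
      ((nilradical (Sha C A lam)).restrictScalars C =
          ((nilradical A).restrictScalars C).map (Sha.incl A lam) ⊔
            (Sha.fil A lam 1).restrictScalars C ∧
        Disjoint (((nilradical A).restrictScalars C).map (Sha.incl A lam))
          ((Sha.fil A lam 1).restrictScalars C)) ∧
      ∀ x ∈ nilradical (ShaHat C A lam),
        ∃ a ∈ nilradical A, ShaHat.coeff 0 x = PiTensorProduct.tprod C fun _ => a) ∧
    ((∀ k : ℕ, 1 ≤ k → ∀ x : ⨂[C]^k A, lam • x = 0 → x = 0) →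
      (∀ k : ℕ, 1 ≤ k → IsReduced (⨂[C]^k A)) →
      IsReduced (Sha C A lam) ∧ IsReduced (ShaHat C A lam)) := by
  have h_factorial : (q.factorial : A) = 0 :=
    (CharP.cast_eq_zero_iff A q _).2 (Nat.dvd_factorial hq le_rfl)
  refine ⟨?_, ?_, fun hann hred => ?_⟩
  · have h_sha := Sha.not_isDomain (lam := lam) h_factorial
    exact ⟨h_sha, fun _ => h_sha (ShaHat.ofSha_injective.isDomain (ShaHat.ofSha A lam))⟩
  · rintro rfl
    have h_sha := Sha.not_isReduced_of_weight_zero (C := C) h_factorial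
    exact ⟨h_sha, fun _ => h_sha (isReduced_of_injective _ ShaHat.ofSha_injective),
      ⟨Sha.nilradical_eq_of_weight_zero h_factorial, Sha.disjoint_map_incl_fil_one _⟩,
      fun x hx => ShaHat.exists_mem_nilradical_coeff_zero_eq hx⟩
  · have h_hat : IsReduced (ShaHat C A lam) := ShaHat.isReduced_of_fil_isRadical <|
      Sha.fil_isRadical (fun n => .of_right_eq_zero_of_smul (hann (n + 1) n.succ_pos))
        fun n => hred (n + 1) n.succ_pos
    exact ⟨isReduced_of_injective _ ShaHat.ofSha_injective, h_hat⟩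

theorem mainTheorem3 {C : Type*} [CommRing C] [Nontrivial C] (q : ℕ) [CharP C q] (hq : 0 < q)
    {A : Type*} [CommRing A] [Algebra C A] (hCA : Function.Injective (algebraMap C A)) (lam : C) :
    -- (1) neither algebra is a domain
    (¬ IsDomain (BaxterShuffle.Sha C A lam) ∧ ¬ IsDomain (BaxterShuffle.ShaHat C A lam)) ∧
    -- (2) weight zero: not reduced, and the nilradicals
    (lam = 0 →
      ¬ IsReduced (BaxterShuffle.Sha C A lam) ∧ ¬ IsReduced (BaxterShuffle.ShaHat C A lam) ∧
      ((nilradical (BaxterShuffle.Sha C A lam)).restrictScalars C =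
          ((nilradical A).restrictScalars C).map (BaxterShuffle.Sha.incl A lam) ⊔
            (BaxterShuffle.Sha.fil A lam 1).restrictScalars C ∧
        Disjoint (((nilradical A).restrictScalars C).map (BaxterShuffle.Sha.incl A lam))
          ((BaxterShuffle.Sha.fil A lam 1).restrictScalars C)) ∧
      ∀ x ∈ nilradical (BaxterShuffle.ShaHat C A lam),
        ∃ a ∈ nilradical A, BaxterShuffle.ShaHat.coeff 0 x = PiTensorProduct.tprod C fun _ => a) ∧
    -- (3) nonzero weight with trivial annihilators, reduced tensor power algebras
    (lam ≠ 0 →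
      (∀ k : ℕ, 1 ≤ k → ∀ x : ⨂[C]^k A, lam • x = 0 → x = 0) →
      (∀ k : ℕ, 1 ≤ k → IsReduced (⨂[C]^k A)) →
      IsReduced (BaxterShuffle.Sha C A lam) ∧ IsReduced (BaxterShuffle.ShaHat C A lam)) := by
  have : Nontrivial A := hCA.nontrivial
  have : CharP A q := charP_of_injective_algebraMap hCA q
  obtain ⟨h_domain, h_weight_zero, h_reduced⟩ := mainTheorem3_general (A := A) q hq lam
  exact ⟨h_domain, h_weight_zero, fun _ => h_reduced⟩
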